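/- Let $\Phi$ be a finite, irreducible, reduced, crystallographic root system in a Euclidean space $E=\mathrm{span}_{\mathbb R}\Phi$ with scalar product $(\cdot,\cdot)$, $W$ its Weyl group, $\Pi=\{\alpha_1,\dots,\alpha_n\}$ a basis of simple roots, $\breve\omega_1,\dots,\breve\omega_n$ the dual basis of $\Pi$ in $E$ (the fundamental coweights), $\theta=\sum_i m_i\alpha_i$ the highest root, and $\mathcal P_\Phi$ the convex hull of $\Phi$. The faces of $\mathcal P_\Phi$ are $\mathcal P_\Phi$ itself and the nonempty intersections of $\mathcal P_\Phi$ with the hyperplanes that do not split it. For $I\subseteq\{1,\dots,n\}$ put $F_I=\{x\in\mathcal P_\Phi \mid (\breve\omega_i,x)=m_i \text{ for all } i\in I\}$. Let $\widehat\Phi=\{\alpha+k\delta\mid \alpha\in\Phi,\ k\in\mathbb Z\}\subset E\oplus\mathbb R\delta$ be the associated affine root system, where the scalar product of $E$ is extended to $E\oplus\mathbb R\delta$ with kernel $\mathbb R\delta$, and let $\alpha_0=-\theta+\delta$ and $\widehat\Pi=\{\alpha_0\}\cup\Pi$. The nodes of the extended Dynkin diagram are $0,1,\dots,n$, with $i\neq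 j$ joined when $(\alpha_i,\alpha_j)\neq0$; the affine node is $0$; a subdiagram is the one induced on a set $J$ of nodes. For a set $J$ of nodes let $\widehat\Phi(J)$ be the root subsystem of $\widehat\Phi$ generated by $\{\alpha_j\mid j\in J\}$ (the smallest subset that contains these roots and is stable under the reflections in its own elements); these are the standard parabolic subsystems. A subset of $\widehat\Phi$ is irreducible if it is nonempty and is not the union of two nonempty mutually orthogonal subsets. **Theorem.** The orbits of the faces of $\mathcal P_\Phi$ under the action of $W$ are in bijection with the connected subdiagrams of the extended Dynkin diagram that contain the affine node: the map that sends such a subdiagram $J$ to the $W$-orbit of $F_{\{1,\dots,n\}\setminus J}$ is a bijection. Equivalently, the orbits of the faces are in bijection with the irreducible standard parabolic subsystems of $\widehat\Phi$ that are not included in $\Phi$: the map $J\mapsto\widehat\Phi(J)$ is a bijection from the connected subdiagrams that contain the affine node onto these subsystems, and the map that sends such a subsystem $\Psi$ to the $W$-orbit of $F_{\{i\in\{1,\dots,n\}\,\mid\,\alpha_i\notin\Psi\}}$ is a bijection onto the orbits of the faces. -/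

import Mathlib

open scoped InnerProductSpace Pointwise

noncomputable section

namespace RootPolytope

variable {ι E N : Type*} [NormedAddCommGroup E] [InnerProductSpace ℝ E]
  [AddCommGroup N] [Module ℝ N]

/-! ### The root polytope and its faces -/

/-- The root polytope: the convex hull of all the roots. -/
def polytope (P : RootPairing ι ℝ E N) : Set E :=
  convexHull ℝ (Set.range P.root)

/-- A face of the root polytope is a nonempty set of the form
`{x ∈ polytope P | l x is maximal on polytope P}` for a linear functional `l`; thus it is either
the whole polytope (`l = 0`) or a nonempty intersection of the polytope with an affine hyperplane
that does not split it. -/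
def IsFace (P : RootPairing ι ℝ E N) (F : Set E) : Prop :=
  F.Nonempty ∧ IsExposed ℝ (polytope P) F

/-- The orbits of the faces of the root polytope under the Weyl group. -/
def faceOrbits (P : RootPairing ι ℝ E N) : Set (Set (Set E)) :=
  {O | ∃ F, IsFace P F ∧ O = MulAction.orbit P.weylGroup F}

/-! ### Highest root, fundamental coweights, standard parabolic faces -/

lemma exists_max_height [Finite ι] {P : RootPairing ι ℝ E N} [P.IsRootSystem]
    [P.IsIrreducible] (b : P.Base) : ∃ i, ∀ j, b.height j ≤ b.height i := by
  have : Nontrivial E := RootPairing.IsIrreducible.nontrivial P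
  have : Nonempty ι := by
    by_contra h
    rw [not_nonempty_iff] at h
    have h1 := RootPairing.IsRootSystem.span_root_eq_top (P := P)
    simp [Set.range_eq_empty] at h1
  exact Finite.exists_max b.height

/-- The highest root, i.e. the root of maximal height. -/
def highestRoot [Finite ι] {P : RootPairing ι ℝ E N} [P.IsRootSystem]
    [P.IsIrreducible] (b : P.Base) : E :=
  P.root (exists_max_height b).choose

lemma inner_nondegenerate [FiniteDimensional ℝ E] :
    LinearMap.BilinForm.Nondegenerate (innerₗ E) := by
  refine ⟨fun x hx => ?_, fun x hx => ?_⟩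
  · exact inner_self_eq_zero.mp (hx x)
  · exact inner_self_eq_zero.mp (hx x)

open Classical in
/-- The fundamental coweights: the basis of `E` dual to the basis of simple roots with respect to
the scalar product. -/
def coweight {P : RootPairing ι ℝ E N} [P.IsRootSystem] (b : P.Base) (i : b.support) : E :=
  haveI : FiniteDimensional ℝ E := b.toWeightBasis.finiteDimensional_of_finite
  LinearMap.BilinForm.dualBasis (innerₗ E) inner_nondegenerate b.toWeightBasis i

/-- The standard parabolic face of a set `I` of simple indices: the set of the points `x` of the
polytope with `(ω̆ᵢ, x) = mᵢ` for all `i ∈ I`, where `mᵢ = (ω̆ᵢ, θ)` is the coefficient of the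
simple root `αᵢ` in the highest root `θ`. -/
def stdFace [Finite ι] {P : RootPairing ι ℝ E N} [P.IsRootSystem]
    [P.IsIrreducible] (b : P.Base) (I : Set b.support) : Set E :=
  {x ∈ polytope P | ∀ i ∈ I, ⟪coweight b i, x⟫_ℝ = ⟪coweight b i, highestRoot b⟫_ℝ}

/-! ### The affine root system

It lives in `E ⊕ ℝ δ`, realised as `E × ℝ`: the pair `(x, k)` stands for `x + k δ`. -/

/-- The roots of the (untwisted) affine root system: `α + k δ` with `α` a root and `k ∈ ℤ`. -/
def affineRoots (P : RootPairing ι ℝ E N) : Set (E × ℝ) :=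
  {v | ∃ (i : ι) (k : ℤ), v = (P.root i, (k : ℝ))}

/-- The finite root system inside the affine one. -/
def finiteRoots (P : RootPairing ι ℝ E N) : Set (E × ℝ) :=
  {v | ∃ i : ι, v = (P.root i, (0 : ℝ))}

/-- The positive semidefinite form on `E ⊕ ℝ δ` that extends the scalar product of `E` and has
kernel `ℝ δ`. -/
def affineForm (v w : E × ℝ) : ℝ := ⟪v.1, w.1⟫_ℝ

/-- The reflection of `E ⊕ ℝ δ` in a vector `v` with `(v, v) ≠ 0`. -/
def affineReflection (v w : E × ℝ) : E × ℝ :=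
  w - (2 * affineForm w v / affineForm v v) • v

/-- The simple roots of the affine root system: `none` is the affine node, with simple root
`α₀ = -θ + δ`, and `some i` is the node of the simple root `αᵢ`. -/
def affineSimpleRoot [Finite ι] {P : RootPairing ι ℝ E N} [P.IsRootSystem]
    [P.IsIrreducible] (b : P.Base) : Option b.support → E × ℝ
  | none => (-highestRoot b, 1)
  | some i => (P.root i, 0)

/-- The graph underlying the extended Dynkin diagram: two distinct nodes are joined when the simple
roots are not orthogonal. (The multiplicities and the orientations of the edges play no role for
the connectedness of subdiagrams.) A subdiagram is the one induced on a set of nodes. -/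
def extendedDynkin [Finite ι] {P : RootPairing ι ℝ E N} [P.IsRootSystem]
    [P.IsIrreducible] (b : P.Base) : SimpleGraph (Option b.support) where
  Adj s t := s ≠ t ∧ affineForm (affineSimpleRoot b s) (affineSimpleRoot b t) ≠ 0
  symm := ⟨fun s t h => ⟨h.1.symm, by
    have h2 := h.2
    simp only [affineForm] at h2 ⊢
    rwa [real_inner_comm]⟩⟩
  loopless := ⟨fun _ h => h.1 rfl⟩

/-- The (node sets of the) connected subdiagrams of the extended Dynkin diagram that contain the
affine node. -/
def connectedSubdiagrams [Finite ι] {P : RootPairing ι ℝ E N} [P.IsRootSystem]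
    [P.IsIrreducible] (b : P.Base) : Set (Set (Option b.support)) :=
  {J | none ∈ J ∧ ((extendedDynkin b).induce J).Connected}

/-- The root subsystem generated by a set `S` of affine roots: the smallest set that contains `S`
and is stable under the reflections in its own elements. -/
inductive Generated (S : Set (E × ℝ)) : E × ℝ → Prop
  | of (v : E × ℝ) : v ∈ S → Generated S v
  | reflect (v w : E × ℝ) : Generated S v → Generated S w → Generated S (affineReflection v w)

/-- The standard parabolic subsystem of the affine root system generated by the simple roots
attached to a set of nodes. -/
def parabolicSubsystem [Finite ι] {P : RootPairing ι ℝ E N} [P.IsRootSystem]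
    [P.IsIrreducible] (b : P.Base) (J : Set (Option b.support)) : Set (E × ℝ) :=
  {v | Generated (affineSimpleRoot b '' J) v}

/-- A set of affine roots is irreducible if it is nonempty and not the union of two nonempty
mutually orthogonal subsets. -/
def IsIrreducibleSubsystem (R : Set (E × ℝ)) : Prop :=
  R.Nonempty ∧ ∀ A B : Set (E × ℝ), A ∪ B = R →
    (∀ v ∈ A, ∀ w ∈ B, affineForm v w = 0) → A = ∅ ∨ B = ∅

/-- The irreducible standard parabolic subsystems of the affine root system that are not included
in the finite root system. -/
def irreducibleParabolics [Finite ι] {P : RootPairing ι ℝ E N} [P.IsRootSystem]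
    [P.IsIrreducible] (b : P.Base) : Set (Set (E × ℝ)) :=
  {R | R ⊆ affineRoots P ∧ (∃ J, R = parabolicSubsystem b J) ∧ IsIrreducibleSubsystem R ∧ ¬ R ⊆ finiteRoots P}

end RootPolytope

end

-- A face is the set where a linear form `l` is maximal, and the Weyl group moves `l` to a form that
-- is nonnegative on the simple roots. The highest root `θ` dominates every root coefficientwise
-- (`coeff_root_le_highestRoot`), so on the polytope `l θ - l x` is a sum of nonnegative terms `(mᵢ
-- - cᵢ(x)) l(αᵢ)`, where `cᵢ` is the coefficient at `αᵢ`. Hence the face is `F_I`, with `I` the set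
-- of simple roots on which `l` is positive (`maximal_iff_mem_stdFace`).
--
-- Let `J` be the complement of `I` together with the affine node. A root whose coefficients outside
-- `J` are those of `θ` differs from `θ` only on the component `K` of the affine node in `J`
-- (`coeff_root_eq_of_notMem_part`); thus `J` and `K` give the same face, and connected subdiagrams
-- suffice. They are also distinguished by the orbits: for connected `J`, the sum of the roots in
-- the face is dominant, orthogonal to the nonaffine simple roots of `J`, and positive on every node
-- outside `J` adjacent to `J` (`inner_rootSum_pos_of_adj`). Conjugate faces have conjugate sums,
-- and conjugate dominant vectors are equal, so neither of two such subdiagrams can have an edge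
-- that leaves it and ends in the other.
--
-- On the affine side, a linear form separates each nonaffine simple root from the other simple
-- roots, so a parabolic subsystem determines its nonaffine nodes. Orthogonal splitting along
-- components matches irreducibility with connectedness.

namespace RootPolytope

-- Coefficients in the basis of simple roots.

section RootCoefficients

variable {ι E N : Type*} [NormedAddCommGroup E] [InnerProductSpace ℝ E]
  [AddCommGroup N] [Module ℝ N] {P : RootPairing ι ℝ E N} [P.IsRootSystem]

/-- The coefficient of a simple root in the expansion of a vector in simple roots. -/
noncomputable def coeff (b : P.Base) (i : b.support) : E →ₗ[ℝ] ℝ := b.toWeightBasis.coord i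

lemma coeff_simple_self (b : P.Base) (i : b.support) : coeff b i (P.root i) = 1 := by
  simp [coeff]

lemma coeff_simple_of_ne (b : P.Base) {i j : b.support} (h : i ≠ j) :
    coeff b i (P.root j) = 0 := by
  simp [coeff, h.symm]

lemma sum_coeff_smul (b : P.Base) (x : E) : ∑ i, coeff b i x • P.root i = x := by
  simpa [coeff] using b.toWeightBasis.sum_repr x

lemma coeff_ext (b : P.Base) {x y : E} (h : ∀ i, coeff b i x = coeff b i y) : x = y := by
  rw [← sum_coeff_smul b x, ← sum_coeff_smul b y]
  simp [h]

lemma inner_eq_sum_coeff (b : P.Base) (x y : E) :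
    ⟪x, y⟫_ℝ = ∑ i, coeff b i x * ⟪P.root i, y⟫_ℝ := by
  conv_lhs => rw [← sum_coeff_smul b x]
  simp [sum_inner, inner_smul_left]

/-- Turns the equations that define `stdFace` into equations between coefficients. -/
lemma inner_coweight (b : P.Base) (i : b.support) (x : E) :
    ⟪coweight b i, x⟫_ℝ = coeff b i x := by
  classical
  have : FiniteDimensional ℝ E := b.toWeightBasis.finiteDimensional_of_finite
  rw [real_inner_comm, inner_eq_sum_coeff b, Finset.sum_eq_single i]
  · have h := LinearMap.BilinForm.apply_dualBasis_left
      (B := innerₗ E) inner_nondegenerate b.toWeightBasis i i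
    have h2 : ⟪coweight b i, P.root i⟫_ℝ = 1 := by
      simpa [coweight, Subsingleton.elim (Classical.decEq b.support)] using h
    rw [real_inner_comm, h2, mul_one]
  · intro j _ hj
    have h := LinearMap.BilinForm.apply_dualBasis_left
      (B := innerₗ E) inner_nondegenerate b.toWeightBasis i j
    have h2 : ⟪coweight b i, P.root j⟫_ℝ = 0 := by
      simpa [coweight, hj] using h
    rw [real_inner_comm, h2, mul_zero]
  · simp

lemma coeff_root_eq {b : P.Base} {k : ι} {f : ι → ℤ}
    (hf : P.root k = ∑ j ∈ b.support, f j • P.root j) (i : b.support) :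
    coeff b i (P.root k) = f i := by
  rw [hf, ← Finset.sum_coe_sort, map_sum, Finset.sum_eq_single i]
  · rw [map_zsmul, coeff_simple_self]; simp
  · intro j _ hj
    rw [map_zsmul, coeff_simple_of_ne b hj.symm, smul_zero]
  · simp

lemma height_eq_sum_coeff (b : P.Base) (k : ι) :
    (b.height k : ℝ) = ∑ i, coeff b i (P.root k) := by
  obtain ⟨f, -, -, hf⟩ := b.exists_root_eq_sum_int k
  rw [RootPairing.Base.height_eq_sum hf, ← Finset.sum_coe_sort]
  simp [coeff_root_eq hf]

lemma coeff_nonneg_of_isPos {b : P.Base} {k : ι} (hk : b.IsPos k) (i : b.support) :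
    0 ≤ coeff b i (P.root k) := by
  obtain ⟨f, -, h, hf⟩ := b.exists_root_eq_sum_int k
  rw [coeff_root_eq hf]
  rcases h with h | h
  · exact_mod_cast h.le i
  · have h1 : b.height k ≤ 0 := by
      rw [RootPairing.Base.height_eq_sum hf]
      exact Finset.sum_nonpos fun j _ => h.le j
    exact absurd hk (by rw [RootPairing.Base.isPos_iff]; omega)

end RootCoefficients

-- Coroots expressed through the invariant scalar product.

section InvariantInner

variable {ι E N : Type*} [NormedAddCommGroup E] [InnerProductSpace ℝ E]
  [AddCommGroup N] [Module ℝ N] {P : RootPairing ι ℝ E N}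

lemma inner_root_self_pos (P : RootPairing ι ℝ E N) (k : ι) : 0 < ⟪P.root k, P.root k⟫_ℝ :=
  real_inner_self_pos.mpr (P.ne_zero k)

lemma coroot'_mul_inner
    (hP : ∀ (i : ι) (x y : E), ⟪P.reflection i x, P.reflection i y⟫_ℝ = ⟪x, y⟫_ℝ)
    (k : ι) (x : E) :
    P.coroot' k x * ⟪P.root k, P.root k⟫_ℝ = 2 * ⟪x, P.root k⟫_ℝ := by
  have h := hP k x (P.root k)
  rw [RootPairing.reflection_apply_self, RootPairing.reflection_apply, inner_neg_right,
    inner_sub_left, real_inner_smul_left] at h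
  linarith

lemma coroot'_eq
    (hP : ∀ (i : ι) (x y : E), ⟪P.reflection i x, P.reflection i y⟫_ℝ = ⟪x, y⟫_ℝ)
    (k : ι) (x : E) :
    P.coroot' k x = 2 * ⟪x, P.root k⟫_ℝ / ⟪P.root k, P.root k⟫_ℝ := by
  rw [eq_div_iff (inner_root_self_pos P k).ne', coroot'_mul_inner hP]

lemma coroot'_pos_iff
    (hP : ∀ (i : ι) (x y : E), ⟪P.reflection i x, P.reflection i y⟫_ℝ = ⟪x, y⟫_ℝ)
    (k : ι) (x : E) : 0 < P.coroot' k x ↔ 0 < ⟪x, P.root k⟫_ℝ := by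
  rw [coroot'_eq hP, div_pos_iff_of_pos_right (inner_root_self_pos P k)]
  simp

lemma coroot'_neg_iff
    (hP : ∀ (i : ι) (x y : E), ⟪P.reflection i x, P.reflection i y⟫_ℝ = ⟪x, y⟫_ℝ)
    (k : ι) (x : E) : P.coroot' k x < 0 ↔ ⟪x, P.root k⟫_ℝ < 0 := by
  have := coroot'_pos_iff hP k (-x)
  simpa using this

lemma coroot'_nonneg_iff
    (hP : ∀ (i : ι) (x y : E), ⟪P.reflection i x, P.reflection i y⟫_ℝ = ⟪x, y⟫_ℝ)
    (k : ι) (x : E) : 0 ≤ P.coroot' k x ↔ 0 ≤ ⟪x, P.root k⟫_ℝ := by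
  rw [← not_lt, coroot'_neg_iff hP, not_lt]

lemma inner_reflection_root
    (hP : ∀ (i : ι) (x y : E), ⟪P.reflection i x, P.reflection i y⟫_ℝ = ⟪x, y⟫_ℝ)
    (k : ι) (x : E) : ⟪P.reflection k x, P.root k⟫_ℝ = -⟪x, P.root k⟫_ℝ := by
  have h := hP k x (P.root k)
  rw [RootPairing.reflection_apply_self, inner_neg_right] at h
  linarith

lemma inner_root_pos_iff [Finite ι] [P.IsCrystallographic]
    (hP : ∀ (i : ι) (x y : E), ⟪P.reflection i x, P.reflection i y⟫_ℝ = ⟪x, y⟫_ℝ)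
    (i j : ι) : 0 < P.pairingIn ℤ i j ↔ 0 < ⟪P.root i, P.root j⟫_ℝ := by
  rw [← coroot'_pos_iff hP, RootPairing.root_coroot'_eq_pairing,
    ← P.algebraMap_pairingIn ℤ]
  simp

lemma inner_simple_nonpos [Finite ι] [P.IsCrystallographic] (b : P.Base)
    (hP : ∀ (i : ι) (x y : E), ⟪P.reflection i x, P.reflection i y⟫_ℝ = ⟪x, y⟫_ℝ)
    {i j : b.support} (hij : i ≠ j) : ⟪P.root i, P.root j⟫_ℝ ≤ 0 := by
  rw [← not_lt, ← inner_root_pos_iff hP, not_lt]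
  exact b.pairingIn_le_zero_of_ne (fun h => hij (Subtype.ext h)) i.2 j.2

lemma coeff_reflection_of_ne [P.IsRootSystem] (b : P.Base) {i j : b.support} (h : i ≠ j) (x : E) :
    coeff b i (P.reflection j x) = coeff b i x := by
  rw [RootPairing.reflection_apply, map_sub, map_smul, coeff_simple_of_ne b h, smul_zero, sub_zero]

lemma coeff_reflection_self [P.IsRootSystem] (b : P.Base) (i : b.support) (x : E) :
    coeff b i (P.reflection i x) = coeff b i x - P.coroot' i x := by
  rw [RootPairing.reflection_apply, map_sub, map_smul, coeff_simple_self, smul_eq_mul, mul_one]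

lemma sum_coeff_reflection [P.IsRootSystem] (b : P.Base) (j : b.support) (x : E) :
    ∑ i, coeff b i (P.reflection j x) = ∑ i, coeff b i x - P.coroot' j x := by
  classical
  rw [← Finset.add_sum_erase _ _ (Finset.mem_univ j),
    ← Finset.add_sum_erase (a := j) _ (fun i => coeff b i x) (Finset.mem_univ j),
    coeff_reflection_self, Finset.sum_congr rfl fun i hi =>
      coeff_reflection_of_ne b (Finset.ne_of_mem_erase hi) x]
  ring

end InvariantInner

-- The highest root.

section HighestRoot

variable {ι E N : Type*} [Finite ι] [NormedAddCommGroup E] [InnerProductSpace ℝ E]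
  [AddCommGroup N] [Module ℝ N] {P : RootPairing ι ℝ E N} [P.IsRootSystem]
  [P.IsIrreducible]

lemma highestRoot_mem_range (b : P.Base) : highestRoot b ∈ Set.range P.root := ⟨_, rfl⟩

lemma sum_coeff_le_highestRoot (b : P.Base) (k : ι) :
    ∑ i, coeff b i (P.root k) ≤ ∑ i, coeff b i (highestRoot b) := by
  rw [highestRoot, ← height_eq_sum_coeff, ← height_eq_sum_coeff]
  exact_mod_cast (exists_max_height b).choose_spec k

/-- A negative product would let a simple reflection produce a root of larger height. -/
lemma inner_highestRoot_simple_nonneg (b : P.Base)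
    (hP : ∀ (i : ι) (x y : E), ⟪P.reflection i x, P.reflection i y⟫_ℝ = ⟪x, y⟫_ℝ)
    (j : b.support) : 0 ≤ ⟪highestRoot b, P.root j⟫_ℝ := by
  obtain ⟨t, ht⟩ := highestRoot_mem_range b
  have h := sum_coeff_le_highestRoot b (P.reflectionPerm j t)
  rw [RootPairing.root_reflectionPerm, sum_coeff_reflection, ← ht] at h
  rw [← ht, ← coroot'_nonneg_iff hP]
  linarith

variable [P.IsCrystallographic] [P.IsReduced]

/-- A simple root outside the support of `θ` has nonpositive product with each simple root in the
support, while its product with `θ` is nonnegative; so all these products vanish. The span of the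
support is then stable under all reflections, and irreducibility makes it the whole space. -/
lemma coeff_highestRoot_pos (b : P.Base)
    (hP : ∀ (i : ι) (x y : E), ⟪P.reflection i x, P.reflection i y⟫_ℝ = ⟪x, y⟫_ℝ)
    (i : b.support) : 0 < coeff b i (highestRoot b) := by
  have hnn : ∀ j, 0 ≤ coeff b j (highestRoot b) := by
    intro j
    refine coeff_nonneg_of_isPos (b := b) (k := (exists_max_height b).choose) ?_ j
    have h := (exists_max_height b).choose_spec i
    rw [RootPairing.Base.height_one_of_mem_support i.2] at h
    rw [RootPairing.Base.isPos_iff]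
    omega
  have horth : ∀ j, coeff b j (highestRoot b) = 0 → ∀ k, 0 < coeff b k (highestRoot b) →
      ⟪P.root k, P.root j⟫_ℝ = 0 := by
    intro j hj k hk
    have hterm : ∀ l, coeff b l (highestRoot b) * ⟪P.root l, P.root j⟫_ℝ ≤ 0 := by
      intro l
      rcases eq_or_ne l j with rfl | hl
      · simp [hj]
      · exact mul_nonpos_of_nonneg_of_nonpos (hnn l) (inner_simple_nonpos b hP hl)
    have hsum := inner_highestRoot_simple_nonneg b hP j
    rw [inner_eq_sum_coeff b] at hsum
    have h0 := (Finset.sum_eq_zero_iff_of_nonpos fun l _ => hterm l).mp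
      (le_antisymm (Finset.sum_nonpos fun l _ => hterm l) hsum) k (Finset.mem_univ k)
    exact (mul_eq_zero.mp h0).resolve_left hk.ne'
  let q : Submodule ℝ E :=
    Submodule.span ℝ ((fun k : b.support => P.root k) '' {k | 0 < coeff b k (highestRoot b)})
  have hq : ∀ j, q ∈ Module.End.invtSubmodule (P.reflection j : E →ₗ[ℝ] E) := by
    rw [← b.forall_mem_support_invtSubmodule_iff]
    intro j hj
    rw [Module.End.mem_invtSubmodule]
    refine Submodule.span_le.mpr ?_
    rintro _ ⟨k, hk, rfl⟩
    change P.reflection j (P.root k) ∈ q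
    rw [RootPairing.reflection_apply]
    have hkq : P.root k ∈ q := Submodule.subset_span ⟨k, hk, rfl⟩
    rcases (hnn ⟨j, hj⟩).eq_or_lt with h | h
    · rw [coroot'_eq hP, horth ⟨j, hj⟩ h.symm k hk]
      simpa using hkq
    · exact q.sub_mem hkq (q.smul_mem _ (Submodule.subset_span ⟨⟨j, hj⟩, h, rfl⟩))
  have hθ : highestRoot b ∈ q := by
    rw [← sum_coeff_smul b (highestRoot b)]
    refine q.sum_mem fun k _ => ?_
    rcases (hnn k).eq_or_lt with h | h
    · rw [← h, zero_smul]; exact q.zero_mem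
    · exact q.smul_mem _ (Submodule.subset_span ⟨k, h, rfl⟩)
  have hbot : q ≠ ⊥ := by
    intro h
    rw [h, Submodule.mem_bot] at hθ
    exact P.ne_zero _ hθ
  have htop := RootPairing.IsIrreducible.eq_top_of_invtSubmodule_reflection q hq hbot
  by_contra hi
  have hle : q ≤ LinearMap.ker (coeff b i) := by
    refine Submodule.span_le.mpr ?_
    rintro _ ⟨k, hk, rfl⟩
    refine coeff_simple_of_ne b ?_
    rintro rfl
    exact hi hk
  have h1 : P.root i ∈ LinearMap.ker (coeff b i) := hle (htop ▸ Submodule.mem_top)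
  rw [LinearMap.mem_ker, coeff_simple_self] at h1
  exact one_ne_zero h1

/-- The highest root dominates every root coefficientwise. -/
lemma coeff_root_le_highestRoot (b : P.Base)
    (hP : ∀ (i : ι) (x y : E), ⟪P.reflection i x, P.reflection i y⟫_ℝ = ⟪x, y⟫_ℝ)
    (k : ι) (i : b.support) : coeff b i (P.root k) ≤ coeff b i (highestRoot b) := by
  -- Among the roots that dominate the given one, a root `g` of maximal height is dominant: a simple
  -- reflection with negative product would raise it within `S`.
  let S : Set ι := {l | ∀ i, coeff b i (P.root k) ≤ coeff b i (P.root l)}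
  obtain ⟨g, hgS, hg⟩ := Set.exists_max_image S b.height S.toFinite ⟨k, fun _ => le_rfl⟩
  have hdom : ∀ j : b.support, 0 ≤ ⟪P.root g, P.root j⟫_ℝ := by
    intro j
    rw [← coroot'_nonneg_iff hP]
    by_contra! hneg
    have hmem : P.reflectionPerm j g ∈ S := by
      intro l
      rw [RootPairing.root_reflectionPerm]
      rcases eq_or_ne l j with rfl | hl
      · rw [coeff_reflection_self]; linarith [hgS l]
      · rw [coeff_reflection_of_ne b hl]; exact hgS l
    have h := hg _ hmem
    have h2 : (b.height (P.reflectionPerm j g) : ℝ) ≤ b.height g := by exact_mod_cast h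
    rw [height_eq_sum_coeff, height_eq_sum_coeff, RootPairing.root_reflectionPerm,
      sum_coeff_reflection] at h2
    linarith
  have hpos : 0 < ⟪highestRoot b, P.root g⟫_ℝ := by
    have hnn : ∀ j ∈ Finset.univ, 0 ≤ coeff b j (highestRoot b) * ⟪P.root j, P.root g⟫_ℝ :=
      fun j _ => mul_nonneg (coeff_highestRoot_pos b hP j).le
        (by rw [real_inner_comm]; exact hdom j)
    rw [inner_eq_sum_coeff b]
    refine lt_of_le_of_ne (Finset.sum_nonneg hnn) fun h0 => ?_
    have hz := (Finset.sum_eq_zero_iff_of_nonneg hnn).mp h0.symm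
    have h1 : ⟪P.root g, P.root g⟫_ℝ = 0 := by
      rw [inner_eq_sum_coeff b]
      refine Finset.sum_eq_zero fun j hj => ?_
      rw [(mul_eq_zero.mp (hz j hj)).resolve_left (coeff_highestRoot_pos b hP j).ne', mul_zero]
    exact (inner_root_self_pos P g).ne' h1
  obtain ⟨t, ht⟩ := highestRoot_mem_range b
  rw [← ht] at hpos ⊢
  rcases eq_or_ne t g with rfl | hne
  · exact hgS i
  -- Positive product makes `θ - g` a root; by maximality of the height of `θ` it is a positive one.
  obtain ⟨d, hd⟩ := P.root_sub_root_mem_of_pairingIn_pos ((inner_root_pos_iff hP t g).mpr hpos) hne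
  have hdpos : b.IsPos d := by
    rw [RootPairing.Base.isPos_iff']
    have h := sum_coeff_le_highestRoot b g
    have h2 : (0 : ℝ) ≤ b.height d := by
      rw [height_eq_sum_coeff, hd]
      simp only [map_sub, Finset.sum_sub_distrib]
      rw [ht]
      linarith
    exact_mod_cast h2
  have h3 := coeff_nonneg_of_isPos hdpos i
  rw [hd, map_sub] at h3
  linarith [hgS i]

end HighestRoot

-- Words in simple reflections and the dominant chamber.

section Words

variable {ι E N : Type*} [NormedAddCommGroup E] [InnerProductSpace ℝ E]
  [AddCommGroup N] [Module ℝ N] {P : RootPairing ι ℝ E N}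

/-- The product of the simple reflections of a word, acting on vectors. -/
def wordAct {b : P.Base} (L : List b.support) (x : E) : E :=
  L.foldr (fun i y => P.reflection i y) x

/-- The product of the simple reflections of a word, acting on indices of roots. -/
def wordPerm {b : P.Base} (L : List b.support) (k : ι) : ι :=
  L.foldr (fun i l => P.reflectionPerm i l) k

@[simp] lemma wordAct_nil {b : P.Base} (x : E) : wordAct ([] : List b.support) x = x := rfl

@[simp] lemma wordAct_cons {b : P.Base} (i : b.support) (L : List b.support) (x : E) :
    wordAct (i :: L) x = P.reflection i (wordAct L x) := rfl

@[simp] lemma wordPerm_cons {b : P.Base} (i : b.support) (L : List b.support) (k : ι) :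
    wordPerm (i :: L) k = P.reflectionPerm i (wordPerm L k) := rfl

lemma wordAct_append {b : P.Base} (L₁ L₂ : List b.support) (x : E) :
    wordAct (L₁ ++ L₂) x = wordAct L₁ (wordAct L₂ x) := by
  simp [wordAct]

lemma root_wordPerm {b : P.Base} (L : List b.support) (k : ι) :
    P.root (wordPerm L k) = wordAct L (P.root k) := by
  induction L with
  | nil => rfl
  | cons i L ih => rw [wordPerm_cons, RootPairing.root_reflectionPerm, ih, wordAct_cons]

lemma wordAct_sub_smul {b : P.Base} (L : List b.support) (c : ℝ) (x y : E) :
    wordAct L (x - c • y) = wordAct L x - c • wordAct L y := by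
  induction L with
  | nil => rfl
  | cons i L ih => simp only [wordAct_cons, ih, map_sub, map_smul]

lemma inner_wordAct
    (hP : ∀ (i : ι) (x y : E), ⟪P.reflection i x, P.reflection i y⟫_ℝ = ⟪x, y⟫_ℝ)
    {b : P.Base} (L : List b.support) (x y : E) : ⟪wordAct L x, wordAct L y⟫_ℝ = ⟪x, y⟫_ℝ := by
  induction L with
  | nil => rfl
  | cons i L ih => rw [wordAct_cons, wordAct_cons, hP, ih]

variable [Finite ι] [P.IsCrystallographic] [P.IsReduced]

/-- The exchange property. -/
lemma exists_shorter_word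
    (hP : ∀ (i : ι) (x y : E), ⟪P.reflection i x, P.reflection i y⟫_ℝ = ⟪x, y⟫_ℝ)
    {b : P.Base} (L : List b.support) (i : b.support) (h : ¬ b.IsPos (wordPerm L i)) :
    ∃ L' : List b.support, L'.length < L.length ∧ ∀ x, wordAct (L ++ [i]) x = wordAct L' x := by
  induction L with
  | nil => exact absurd (RootPairing.Base.isPos_of_mem_support i.2) h
  | cons j L ih =>
    by_cases hL : b.IsPos (wordPerm L i)
    -- A simple reflection makes only its own root negative among the positive roots. So `L` sends
    -- `αᵢ` to `αⱼ`, hence `L sᵢ = sⱼ L`, and the outer `sⱼ` cancels.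
    · have hij : wordPerm L i = j := by
        by_contra hne
        exact h (hL.reflectionPerm j.2 hne)
      have hroot : wordAct L (P.root i) = P.root j := by rw [← root_wordPerm, hij]
      refine ⟨L, by simp, fun x => ?_⟩
      have hc : P.coroot' j (wordAct L x) = P.coroot' i x := by
        rw [coroot'_eq hP, coroot'_eq hP, ← hroot, inner_wordAct hP, inner_wordAct hP]
      have hcomm : wordAct L (P.reflection i x) = P.reflection j (wordAct L x) := by
        rw [RootPairing.reflection_apply, wordAct_sub_smul, hroot,
          RootPairing.reflection_apply, hc]
      simp only [List.cons_append, wordAct_cons, wordAct_append, wordAct_nil, hcomm,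
        RootPairing.reflection_same]
    · obtain ⟨L', hlen, hL'⟩ := ih hL
      exact ⟨j :: L', by simpa using hlen, fun x => by simp [hL']⟩

/-- A dominant vector dominates all its images under products of simple reflections. -/
lemma coeff_wordAct_le [P.IsRootSystem]
    (hP : ∀ (i : ι) (x y : E), ⟪P.reflection i x, P.reflection i y⟫_ℝ = ⟪x, y⟫_ℝ)
    {b : P.Base} {x : E} (hx : ∀ i : b.support, 0 ≤ ⟪x, P.root i⟫_ℝ) (L : List b.support)
    (j : b.support) : coeff b j (wordAct L x) ≤ coeff b j x := by
  induction hn : L.length using Nat.strong_induction_on generalizing L with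
  | _ n ih =>
    rcases L.eq_nil_or_concat' with rfl | ⟨L, i, rfl⟩
    · exact le_rfl
    · have hlen : L.length < n := by simp [← hn]
      -- If `L αᵢ` is positive, the last letter only subtracts a nonnegative multiple of it;
      -- otherwise the exchange property shortens the word.
      by_cases hpos : b.IsPos (wordPerm L i)
      · rw [wordAct_append, wordAct_cons, wordAct_nil, RootPairing.reflection_apply,
          wordAct_sub_smul, ← root_wordPerm, map_sub, map_smul, smul_eq_mul]
        have h1 := ih _ hlen L rfl
        have h2 := mul_nonneg ((coroot'_nonneg_iff hP i x).mpr (hx i))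
          (coeff_nonneg_of_isPos hpos j)
        linarith
      · obtain ⟨L', hL', hact⟩ := exists_shorter_word hP L i hpos
        rw [hact]
        exact ih _ (hL'.trans hlen) L' rfl

/-- The Weyl group is generated by the simple reflections. -/
lemma exists_word (b : P.Base) (w : P.weylGroup) :
    ∃ L : List b.support, ∀ x : E, w • x = wordAct L x := by
  have hrefl : ∀ k, ∃ L : List b.support, ∀ x : E, P.reflection k x = wordAct L x := by
    let := P.indexNeg
    intro k
    induction k using b.induction_reflect with
    | h₀ i ih =>
      obtain ⟨L, hL⟩ := ih
      refine ⟨L, fun x => ?_⟩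
      rw [← hL, RootPairing.reflection_reflectionPerm]
      simp
    | h₁ i hi => exact ⟨[⟨i, hi⟩], fun x => rfl⟩
    | h₂ i j ih hj =>
      obtain ⟨L, hL⟩ := ih
      refine ⟨⟨j, hj⟩ :: (L ++ [⟨j, hj⟩]), fun x => ?_⟩
      rw [RootPairing.reflection_reflectionPerm]
      simp [wordAct_append, hL]
  obtain ⟨g, hg⟩ := w
  induction hg using RootPairing.weylGroup.induction with
  | mem i => exact hrefl i
  | one => exact ⟨[], fun x => rfl⟩
  | mul g₁ g₂ h₁ h₂ ih₁ ih₂ =>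
    obtain ⟨L₁, hL₁⟩ := ih₁
    obtain ⟨L₂, hL₂⟩ := ih₂
    exact ⟨L₁ ++ L₂, fun x => by
      rw [wordAct_append, ← hL₁, ← hL₂]; rfl⟩

/-- The orbits of the Weyl group meet the closed dominant chamber at most once. -/
lemma eq_of_dominant_of_smul_eq [P.IsRootSystem]
    (hP : ∀ (i : ι) (x y : E), ⟪P.reflection i x, P.reflection i y⟫_ℝ = ⟪x, y⟫_ℝ)
    (b : P.Base) {x y : E} (hx : ∀ i : b.support, 0 ≤ ⟪x, P.root i⟫_ℝ)
    (hy : ∀ i : b.support, 0 ≤ ⟪y, P.root i⟫_ℝ) (w : P.weylGroup) (h : w • x = y) : x = y := by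
  obtain ⟨L₁, hL₁⟩ := exists_word b w
  obtain ⟨L₂, hL₂⟩ := exists_word b w⁻¹
  have h' : w⁻¹ • y = x := by rw [← h, inv_smul_smul]
  refine coeff_ext b fun j => le_antisymm ?_ ?_
  · rw [← h', hL₂]; exact coeff_wordAct_le hP hy L₂ j
  · rw [← h, hL₁]; exact coeff_wordAct_le hP hx L₁ j

end Words

-- Moving a linear form into the dominant chamber.

section Dominance

variable {ι E N : Type*} [Finite ι] [NormedAddCommGroup E] [InnerProductSpace ℝ E]
  [AddCommGroup N] [Module ℝ N] {P : RootPairing ι ℝ E N} [P.IsRootSystem]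

/-- The image `w • x` depends only on the permutation of the roots induced by `w`. -/
lemma finite_range_weylGroup_smul (b : P.Base) (x : E) :
    (Set.range fun w : P.weylGroup => w • x).Finite := by
  have hfac : ∀ w : P.weylGroup,
      w • x = ∑ i : b.support, coeff b i x • P.root (P.weylGroupToPerm w i) := by
    intro w
    conv_lhs => rw [← sum_coeff_smul b x]
    rw [Finset.smul_sum]
    refine Finset.sum_congr rfl fun i _ => ?_
    rw [← RootPairing.weylGroup_apply_root]
    exact smul_comm (w : P.Aut) _ _
  refine (Set.finite_range fun σ : Equiv.Perm ι =>
    ∑ i : b.support, coeff b i x • P.root (σ i)).subset ?_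
  rintro _ ⟨w, rfl⟩
  exact ⟨P.weylGroupToPerm w, (hfac w).symm⟩

/-- Every linear form is moved by the Weyl group to one that is nonnegative on the simple roots. -/
lemma exists_weylGroup_dominant
    (hP : ∀ (i : ι) (x y : E), ⟪P.reflection i x, P.reflection i y⟫_ℝ = ⟪x, y⟫_ℝ)
    (b : P.Base) (l : E →ₗ[ℝ] ℝ) : ∃ w : P.weylGroup, ∀ i : b.support, 0 ≤ l (w • P.root i) := by
  -- This vector has product 1 with every simple root. At a maximum of `l` on its orbit, passing
  -- from `w` to `w sᵢ` subtracts a positive multiple of `l (w αᵢ)`, which therefore cannot be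
  -- negative.
  let r : E := ∑ i, coweight b i
  have hr : ∀ i : b.support, 0 < ⟪r, P.root i⟫_ℝ := by
    intro i
    have : ⟪r, P.root i⟫_ℝ = 1 := by
      simp only [r, sum_inner, inner_coweight]
      rw [Finset.sum_eq_single i, coeff_simple_self]
      · exact fun j _ hj => coeff_simple_of_ne b hj
      · simp
    rw [this]; exact one_pos
  obtain ⟨_, ⟨w, rfl⟩, hw⟩ := Set.exists_max_image _ l (finite_range_weylGroup_smul b r)
    ⟨_, 1, rfl⟩
  refine ⟨w, fun i => ?_⟩
  have h := hw _ ⟨w * RootPairing.weylGroup.ofIdx P i, rfl⟩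
  have hexp : (w * RootPairing.weylGroup.ofIdx P i) • r =
      w • r - P.coroot' i r • (w • P.root i) := by
    rw [mul_smul]
    change w • (P.reflection i r) = _
    rw [RootPairing.reflection_apply, smul_sub]
    congr 1
    exact smul_comm (w : P.Aut) _ _
  simp only [hexp, map_sub, map_smul, smul_eq_mul] at h
  have hc := (coroot'_pos_iff hP i r).mpr (hr i)
  by_contra! hneg
  nlinarith [mul_neg_of_pos_of_neg hc hneg]

end Dominance

-- Every face is conjugate to a standard parabolic face.

section Polytope

variable {ι E N : Type*} [NormedAddCommGroup E] [InnerProductSpace ℝ E]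
  [AddCommGroup N] [Module ℝ N] {P : RootPairing ι ℝ E N}

lemma root_mem_polytope (P : RootPairing ι ℝ E N) (k : ι) : P.root k ∈ polytope P :=
  subset_convexHull ℝ _ ⟨k, rfl⟩

lemma smul_mem_polytope (w : P.weylGroup) {x : E} (hx : x ∈ polytope P) : w • x ∈ polytope P := by
  let f : E →ₗ[ℝ] E :=
    { toFun := fun y => w • y
      map_add' := fun y z => smul_add w y z
      map_smul' := fun c y => smul_comm (w : P.Aut) c y }
  have h : f '' polytope P ⊆ polytope P := by
    rw [polytope, f.image_convexHull]
    refine convexHull_mono ?_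
    rintro _ ⟨_, ⟨k, rfl⟩, rfl⟩
    exact ⟨_, (P.weylGroup_apply_root w k).symm⟩
  exact h ⟨x, hx, rfl⟩

lemma smul_mem_polytope_iff (w : P.weylGroup) {x : E} : w • x ∈ polytope P ↔ x ∈ polytope P :=
  ⟨fun h => by simpa using smul_mem_polytope w⁻¹ h, smul_mem_polytope w⟩

variable [Finite ι] [P.IsRootSystem] [P.IsIrreducible]

lemma mem_stdFace (b : P.Base) {I : Set b.support} {x : E} :
    x ∈ stdFace b I ↔ x ∈ polytope P ∧ ∀ i ∈ I, coeff b i x = coeff b i (highestRoot b) := by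
  simp [stdFace, inner_coweight]

lemma root_mem_stdFace (b : P.Base) {I : Set b.support} {k : ι} :
    P.root k ∈ stdFace b I ↔ ∀ i ∈ I, coeff b i (P.root k) = coeff b i (highestRoot b) := by
  simp [mem_stdFace, root_mem_polytope]

lemma highestRoot_mem_polytope (b : P.Base) : highestRoot b ∈ polytope P :=
  root_mem_polytope P _

lemma highestRoot_mem_stdFace (b : P.Base) (I : Set b.support) : highestRoot b ∈ stdFace b I :=
  (mem_stdFace b).mpr ⟨highestRoot_mem_polytope b, fun _ _ => rfl⟩

/-- The reflection in `αⱼ` changes only the coefficient at `j`, which is unconstrained. -/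
lemma smul_stdFace_of_notMem (b : P.Base) {I : Set b.support} {j : b.support} (hj : j ∉ I) :
    RootPairing.weylGroup.ofIdx P j • stdFace b I = stdFace b I := by
  have hsub : ∀ x ∈ stdFace b I, RootPairing.weylGroup.ofIdx P j • x ∈ stdFace b I := by
    intro x hx
    rw [mem_stdFace] at hx ⊢
    refine ⟨smul_mem_polytope _ hx.1, fun i hi => ?_⟩
    rw [← hx.2 i hi]
    exact coeff_reflection_of_ne b (ne_of_mem_of_not_mem hi hj) x
  refine Set.Subset.antisymm ?_ fun x hx => ?_
  · rintro _ ⟨x, hx, rfl⟩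
    exact hsub x hx
  · refine ⟨_, hsub x hx, ?_⟩
    exact P.reflection_same j x

variable [P.IsCrystallographic] [P.IsReduced]

lemma coeff_le_of_mem_polytope (b : P.Base)
    (hP : ∀ (i : ι) (x y : E), ⟪P.reflection i x, P.reflection i y⟫_ℝ = ⟪x, y⟫_ℝ)
    {x : E} (hx : x ∈ polytope P) (i : b.support) :
    coeff b i x ≤ coeff b i (highestRoot b) := by
  have h : polytope P ⊆ {y | coeff b i y ≤ coeff b i (highestRoot b)} := by
    refine convexHull_min ?_ (convex_halfSpace_le (coeff b i).isLinear _)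
    rintro _ ⟨k, rfl⟩
    exact coeff_root_le_highestRoot b hP k i
  exact h hx

lemma linear_le_highestRoot (b : P.Base)
    (hP : ∀ (i : ι) (x y : E), ⟪P.reflection i x, P.reflection i y⟫_ℝ = ⟪x, y⟫_ℝ)
    (l : E →ₗ[ℝ] ℝ) (hl : ∀ i : b.support, 0 ≤ l (P.root i)) {x : E} (hx : x ∈ polytope P) :
    l x ≤ l (highestRoot b) := by
  rw [← sum_coeff_smul b x, ← sum_coeff_smul b (highestRoot b), map_sum, map_sum]
  refine Finset.sum_le_sum fun i _ => ?_
  rw [map_smul, map_smul]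
  exact mul_le_mul_of_nonneg_right (coeff_le_of_mem_polytope b hP hx i) (hl i)

/-- The points of the polytope where a dominant linear form is maximal make up a standard
parabolic face. -/
lemma maximal_iff_mem_stdFace (b : P.Base)
    (hP : ∀ (i : ι) (x y : E), ⟪P.reflection i x, P.reflection i y⟫_ℝ = ⟪x, y⟫_ℝ)
    (l : E →ₗ[ℝ] ℝ) (hl : ∀ i : b.support, 0 ≤ l (P.root i)) (x : E) :
    (x ∈ polytope P ∧ ∀ y ∈ polytope P, l y ≤ l x) ↔
      x ∈ stdFace b {i | 0 < l (P.root i)} := by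
  rw [mem_stdFace]
  refine and_congr_right fun hx => ?_
  have hmax : (∀ y ∈ polytope P, l y ≤ l x) ↔ l (highestRoot b) - l x = 0 := by
    constructor
    · intro h
      have h1 := h _ (highestRoot_mem_polytope b)
      have h2 := linear_le_highestRoot b hP l hl hx
      linarith
    · intro h y hy
      have := linear_le_highestRoot b hP l hl hy
      linarith
  have hsum : l (highestRoot b) - l x =
      ∑ i, (coeff b i (highestRoot b) - coeff b i x) * l (P.root i) := by
    conv_lhs => rw [← map_sub, ← sum_coeff_smul b (highestRoot b - x), map_sum]
    simp
  rw [hmax, hsum, Finset.sum_eq_zero_iff_of_nonneg fun i _ =>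
    mul_nonneg (sub_nonneg.mpr (coeff_le_of_mem_polytope b hP hx i)) (hl i)]
  constructor
  · intro h i hi
    have := (mul_eq_zero.mp (h i (Finset.mem_univ i))).resolve_right (ne_of_gt hi)
    linarith
  · intro h i _
    rcases (hl i).eq_or_lt with h0 | h0
    · rw [← h0, mul_zero]
    · rw [h i h0, sub_self, zero_mul]

lemma isFace_stdFace (b : P.Base)
    (hP : ∀ (i : ι) (x y : E), ⟪P.reflection i x, P.reflection i y⟫_ℝ = ⟪x, y⟫_ℝ)
    (I : Set b.support) : IsFace P (stdFace b I) := by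
  classical
  have : FiniteDimensional ℝ E := b.toWeightBasis.finiteDimensional_of_finite
  refine ⟨⟨_, highestRoot_mem_stdFace b I⟩, fun _ => ?_⟩
  -- A dominant form that is positive exactly on the simple roots in `I`.
  let l : E →ₗ[ℝ] ℝ := ∑ i, if i ∈ I then coeff b i else 0
  have hl : ∀ j : b.support, l (P.root j) = if j ∈ I then 1 else 0 := by
    intro j
    simp only [l, LinearMap.sum_apply]
    rw [Finset.sum_eq_single j]
    · split_ifs
      · exact coeff_simple_self b j
      · rfl
    · intro i _ hi
      split_ifs
      · exact coeff_simple_of_ne b hi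
      · rfl
    · simp
  have hI : {i : b.support | 0 < l (P.root i)} = I := by
    ext i
    by_cases hi : i ∈ I <;> simp [hl, hi]
  refine ⟨LinearMap.toContinuousLinearMap l, ?_⟩
  ext x
  have h := maximal_iff_mem_stdFace b hP l
    (fun i => by rw [hl]; split_ifs <;> simp) x
  rw [hI] at h
  exact h.symm

lemma exists_smul_eq_stdFace (b : P.Base)
    (hP : ∀ (i : ι) (x y : E), ⟪P.reflection i x, P.reflection i y⟫_ℝ = ⟪x, y⟫_ℝ)
    {F : Set E} (hF : IsFace P F) :
    ∃ (w : P.weylGroup) (I : Set b.support), w • stdFace b I = F := by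
  obtain ⟨l, hl⟩ := hF.2 hF.1
  obtain ⟨w, hw⟩ := exists_weylGroup_dominant hP b (l : E →ₗ[ℝ] ℝ)
  let l' : E →ₗ[ℝ] ℝ :=
    { toFun := fun y => l (w • y)
      map_add' := fun y z => by rw [smul_add, map_add]
      map_smul' := fun c y => by
        have h : w • c • y = c • w • y := smul_comm (w : P.Aut) c y
        rw [h, map_smul]; rfl }
  refine ⟨w, {i | 0 < l' (P.root i)}, ?_⟩
  ext x
  rw [Set.mem_smul_set_iff_inv_smul_mem, ← maximal_iff_mem_stdFace b hP l' hw, hl,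
    smul_mem_polytope_iff]
  refine and_congr_right fun _ => ?_
  change (∀ y ∈ polytope P, l (w • y) ≤ l (w • w⁻¹ • x)) ↔ _
  rw [smul_inv_smul]
  refine ⟨fun h y hy => ?_, fun h y hy => h _ (smul_mem_polytope w hy)⟩
  simpa using h (w⁻¹ • y) (smul_mem_polytope w⁻¹ hy)

end Polytope

-- The sum of the roots in a face as an equivariant invariant.

section RootSum

variable {ι E N : Type*} [NormedAddCommGroup E] [InnerProductSpace ℝ E]
  [AddCommGroup N] [Module ℝ N] {P : RootPairing ι ℝ E N}

/-- The sum of the roots in a set. -/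
noncomputable def rootSum (P : RootPairing ι ℝ E N) (F : Set E) : E :=
  ∑ᶠ k ∈ {k | P.root k ∈ F}, P.root k

lemma smul_rootSum [Finite ι] (w : P.weylGroup) (F : Set E) :
    w • rootSum P F = rootSum P (w • F) := by
  have hset : {k | P.root k ∈ w • F} = P.weylGroupToPerm w '' {k | P.root k ∈ F} := by
    ext k
    rw [Equiv.image_eq_preimage_symm]
    simp only [Set.mem_preimage, Set.mem_ofPred_eq]
    rw [Set.mem_smul_set_iff_inv_smul_mem]
    have : w⁻¹ • P.root k = P.root ((P.weylGroupToPerm w).symm k) := by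
      rw [inv_smul_eq_iff, RootPairing.weylGroup_apply_root, Equiv.apply_symm_apply]
    rw [this]
  rw [rootSum, rootSum, hset, finsum_mem_image (Equiv.injective _).injOn]
  rw [show w • ∑ᶠ k ∈ {k | P.root k ∈ F}, P.root k =
    DistribSMul.toAddMonoidHom E w (∑ᶠ k ∈ {k | P.root k ∈ F}, P.root k) from rfl,
    AddMonoidHom.map_finsum_mem _ _ (Set.toFinite _)]
  exact finsum_mem_congr rfl fun k _ => P.weylGroup_apply_root w k

lemma inner_rootSum [Finite ι] (F : Set E) (y : E) :
    ⟪rootSum P F, y⟫_ℝ = ∑ᶠ k ∈ {k | P.root k ∈ F}, ⟪P.root k, y⟫_ℝ := by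
  have h := AddMonoidHom.map_finsum_mem (P.root) ((innerₗ E).flip y).toAddMonoidHom
    (Set.toFinite {k | P.root k ∈ F})
  exact h

variable [Finite ι] [P.IsRootSystem] [P.IsIrreducible]

/-- The reflection in `αⱼ` preserves the face, so it fixes the sum of its roots. -/
lemma inner_rootSum_stdFace_of_notMem (b : P.Base)
    (hP : ∀ (i : ι) (x y : E), ⟪P.reflection i x, P.reflection i y⟫_ℝ = ⟪x, y⟫_ℝ)
    {I : Set b.support} {j : b.support} (hj : j ∉ I) :
    ⟪rootSum P (stdFace b I), P.root j⟫_ℝ = 0 := by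
  have h := smul_rootSum (RootPairing.weylGroup.ofIdx P j) (stdFace b I)
  rw [smul_stdFace_of_notMem b hj] at h
  have h2 := inner_reflection_root hP j (rootSum P (stdFace b I))
  have h3 : P.reflection j (rootSum P (stdFace b I)) = rootSum P (stdFace b I) := h
  rw [h3] at h2
  linarith

variable [P.IsCrystallographic] [P.IsReduced]

/-- Otherwise reflecting would push the coefficient at `j` above that of `θ`. -/
lemma inner_root_nonneg_of_coeff_eq (b : P.Base)
    (hP : ∀ (i : ι) (x y : E), ⟪P.reflection i x, P.reflection i y⟫_ℝ = ⟪x, y⟫_ℝ)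
    {k : ι} {j : b.support} (h : coeff b j (P.root k) = coeff b j (highestRoot b)) :
    0 ≤ ⟪P.root k, P.root j⟫_ℝ := by
  have h1 := coeff_root_le_highestRoot b hP (P.reflectionPerm j k) j
  rw [RootPairing.root_reflectionPerm, coeff_reflection_self, h] at h1
  rw [← coroot'_nonneg_iff hP]
  linarith

lemma inner_rootSum_stdFace_nonneg (b : P.Base)
    (hP : ∀ (i : ι) (x y : E), ⟪P.reflection i x, P.reflection i y⟫_ℝ = ⟪x, y⟫_ℝ)
    (I : Set b.support) (j : b.support) : 0 ≤ ⟪rootSum P (stdFace b I), P.root j⟫_ℝ := by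
  by_cases hj : j ∈ I
  · rw [inner_rootSum]
    refine finsum_nonneg fun k => finsum_nonneg fun hk => ?_
    exact inner_root_nonneg_of_coeff_eq b hP ((root_mem_stdFace b).mp hk j hj)
  · rw [inner_rootSum_stdFace_of_notMem b hP hj]

lemma inner_rootSum_stdFace_pos (b : P.Base)
    (hP : ∀ (i : ι) (x y : E), ⟪P.reflection i x, P.reflection i y⟫_ℝ = ⟪x, y⟫_ℝ)
    {I : Set b.support} {j : b.support} (hj : j ∈ I) {k : ι} (hk : P.root k ∈ stdFace b I)
    (hpos : 0 < ⟪P.root k, P.root j⟫_ℝ) : 0 < ⟪rootSum P (stdFace b I), P.root j⟫_ℝ := by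
  rw [inner_rootSum]
  have hnn : ∀ l ∈ (Set.toFinite {k | P.root k ∈ stdFace b I}).toFinset,
      0 ≤ ⟪P.root l, P.root j⟫_ℝ := fun l hl =>
    inner_root_nonneg_of_coeff_eq b hP ((root_mem_stdFace b).mp (by simpa using hl) j hj)
  rw [finsum_mem_eq_finite_toFinset_sum _ (Set.toFinite _)]
  exact Finset.sum_pos' hnn ⟨k, by simpa using hk, hpos⟩

end RootSum

-- Connected induced subgraphs.

section Connectivity

variable {V : Type*} {G : SimpleGraph V}

lemma forall_of_induce_connected {J : Set V} (hJ : (G.induce J).Connected) {p : V → Prop} {a : V}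
    (ha : a ∈ J) (hpa : p a) (h : ∀ u ∈ J, ∀ v ∈ J, G.Adj u v → p u → p v) :
    ∀ v ∈ J, p v := by
  intro v hv
  have hstep : ∀ x y : J, (G.induce J).Walk x y → p x → p y := by
    intro x y W
    induction W with
    | nil => exact id
    | cons hadj _ ih => exact fun hx => ih (h _ (Subtype.property _) _ (Subtype.property _) hadj hx)
  obtain ⟨W⟩ := hJ.preconnected ⟨a, ha⟩ ⟨v, hv⟩
  exact hstep _ _ W hpa

/-- A set of nodes contains a connected part around each of its nodes that is closed under
adjacency. -/
lemma exists_connected_part {J : Set V} {a : V} (ha : a ∈ J) (G : SimpleGraph V) :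
    ∃ K ⊆ J, a ∈ K ∧ (G.induce K).Connected ∧ ∀ u ∈ K, ∀ v ∈ J, G.Adj u v → v ∈ K := by
  let K : Set V := {v | Relation.ReflTransGen (fun u v => G.Adj u v ∧ v ∈ J) a v}
  have haK : a ∈ K := Relation.ReflTransGen.refl
  have hclosed : ∀ u ∈ K, ∀ v ∈ J, G.Adj u v → v ∈ K := fun u hu v hv h =>
    Relation.ReflTransGen.tail hu ⟨h, hv⟩
  refine ⟨K, fun v hv => ?_, haK, ?_, hclosed⟩
  · induction hv with
    | refl => exact ha
    | tail _ h _ => exact h.2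
  · have hreach : ∀ v (hv : v ∈ K), (G.induce K).Reachable ⟨a, haK⟩ ⟨v, hv⟩ := by
      intro v hv
      have hv' : Relation.ReflTransGen (fun u v => G.Adj u v ∧ v ∈ J) a v := hv
      induction hv' with
      | refl => exact SimpleGraph.Reachable.refl _
      | tail hu h ih => exact (ih hu).trans (SimpleGraph.Adj.reachable h.1)
    have : Nonempty K := ⟨⟨a, haK⟩⟩
    exact ⟨fun x y => (hreach x x.2).symm.trans (hreach y y.2)⟩

end Connectivity

-- Faces and connected subdiagrams.

section Diagram

variable {ι E N : Type*} [Finite ι] [NormedAddCommGroup E] [InnerProductSpace ℝ E]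
  [AddCommGroup N] [Module ℝ N] {P : RootPairing ι ℝ E N} [P.IsRootSystem]
  [P.IsIrreducible]

lemma inner_simple_eq_zero_of_not_adj (b : P.Base) {i j : b.support} (hij : i ≠ j)
    (h : ¬ (extendedDynkin b).Adj (some i) (some j)) : ⟪P.root i, P.root j⟫_ℝ = 0 := by
  by_contra hne
  exact h ⟨by simpa using hij, hne⟩

lemma inner_highestRoot_eq_zero_of_not_adj (b : P.Base) {j : b.support}
    (h : ¬ (extendedDynkin b).Adj none (some j)) : ⟪highestRoot b, P.root j⟫_ℝ = 0 := by
  by_contra hne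
  exact h ⟨by simp, by simpa [affineForm, affineSimpleRoot] using hne⟩

lemma inner_simple_ne_zero_of_adj (b : P.Base) {i j : b.support}
    (h : (extendedDynkin b).Adj (some i) (some j)) : ⟪P.root i, P.root j⟫_ℝ ≠ 0 := h.2

lemma inner_highestRoot_ne_zero_of_adj (b : P.Base) {j : b.support}
    (h : (extendedDynkin b).Adj none (some j)) : ⟪highestRoot b, P.root j⟫_ℝ ≠ 0 := by
  simpa [affineForm, affineSimpleRoot] using h.2

/-- For a root `x` and a simple root `y`, every summand with `αᵢ ≠ y` is nonnegative. -/
lemma inner_eq_highestRoot_sub (b : P.Base) (x y : E) :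
    ⟪x, y⟫_ℝ = ⟪highestRoot b, y⟫_ℝ +
      ∑ i, (coeff b i (highestRoot b) - coeff b i x) * -⟪P.root i, y⟫_ℝ := by
  have h := inner_eq_sum_coeff b (highestRoot b - x) y
  rw [inner_sub_left] at h
  simp only [map_sub] at h
  simp only [mul_neg, Finset.sum_neg_distrib, ← h]
  ring

variable [P.IsCrystallographic] [P.IsReduced]

/-- A root which agrees with the highest root at a node, but not at a neighbour of this node, has
positive scalar product with the simple root of the node. -/
lemma inner_root_pos_of_adj (b : P.Base)
    (hP : ∀ (i : ι) (x y : E), ⟪P.reflection i x, P.reflection i y⟫_ℝ = ⟪x, y⟫_ℝ)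
    {k : ι} {u : Option b.support} {j : b.support}
    (hj : coeff b j (P.root k) = coeff b j (highestRoot b))
    (hadj : (extendedDynkin b).Adj u (some j))
    (hu : ∀ i, u = some i → coeff b i (P.root k) < coeff b i (highestRoot b)) :
    0 < ⟪P.root k, P.root j⟫_ℝ := by
  rw [inner_eq_highestRoot_sub b]
  have hnn : ∀ i ∈ Finset.univ, 0 ≤ (coeff b i (highestRoot b) - coeff b i (P.root k)) *
      -⟪P.root i, P.root j⟫_ℝ := by
    intro i _
    rcases eq_or_ne i j with rfl | hi
    · rw [hj, sub_self, zero_mul]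
    · exact mul_nonneg (sub_nonneg.mpr (coeff_root_le_highestRoot b hP k i))
        (neg_nonneg.mpr (inner_simple_nonpos b hP hi))
  have hθ := inner_highestRoot_simple_nonneg b hP j
  -- The neighbour supplies the strictly positive term: the product with `θ` for the affine node,
  -- its own summand otherwise.
  cases u with
  | none =>
    exact add_pos_of_pos_of_nonneg
      (lt_of_le_of_ne hθ (inner_highestRoot_ne_zero_of_adj b hadj).symm) (Finset.sum_nonneg hnn)
  | some i =>
    refine add_pos_of_nonneg_of_pos hθ (Finset.sum_pos' hnn ⟨i, Finset.mem_univ i, ?_⟩)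
    have hij : i ≠ j := fun h => hadj.1 (congrArg some h)
    exact mul_pos (sub_pos.mpr (hu i rfl)) (neg_pos.mpr
      (lt_of_le_of_ne (inner_simple_nonpos b hP hij) (inner_simple_ne_zero_of_adj b hadj)))

/-- Start from `θ` and follow a path in `J` from the affine node. If the coefficient at the next
node is still maximal, the reflection there lowers it and leaves the coefficients outside `J`
unchanged. At the affine node the strict inequality is vacuous. -/
lemma exists_root_coeff_lt (b : P.Base)
    (hP : ∀ (i : ι) (x y : E), ⟪P.reflection i x, P.reflection i y⟫_ℝ = ⟪x, y⟫_ℝ)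
    {J : Set (Option b.support)} (hJ : J ∈ connectedSubdiagrams b) :
    ∀ u ∈ J, ∃ k, P.root k ∈ stdFace b {i | some i ∉ J} ∧
      ∀ i, u = some i → coeff b i (P.root k) < coeff b i (highestRoot b) := by
  refine forall_of_induce_connected hJ.2 hJ.1 ?_ ?_
  · exact ⟨_, highestRoot_mem_stdFace b _, by simp⟩
  · rintro u - v hv hadj ⟨k, hk, hku⟩
    cases v with
    | none => exact ⟨k, hk, by simp⟩
    | some j =>
      rcases (coeff_root_le_highestRoot b hP k j).lt_or_eq with hlt | heq
      · exact ⟨k, hk, fun i hi => by cases hi; exact hlt⟩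
      · have hpos := inner_root_pos_of_adj b hP heq hadj hku
        rw [← coroot'_pos_iff hP] at hpos
        refine ⟨P.reflectionPerm j k, ?_, ?_⟩
        · rw [root_mem_stdFace] at hk ⊢
          intro i hi
          rw [RootPairing.root_reflectionPerm, coeff_reflection_of_ne b, hk i hi]
          rintro rfl
          exact hi hv
        · intro i hi
          cases hi
          rw [RootPairing.root_reflectionPerm, coeff_reflection_self, heq]
          linarith

/-- The nodes adjacent to a connected subdiagram containing the affine node are detected by the sum
of the roots in the corresponding face. -/
lemma inner_rootSum_pos_of_adj (b : P.Base)
    (hP : ∀ (i : ι) (x y : E), ⟪P.reflection i x, P.reflection i y⟫_ℝ = ⟪x, y⟫_ℝ)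
    {J : Set (Option b.support)} (hJ : J ∈ connectedSubdiagrams b) {u : Option b.support}
    (hu : u ∈ J) {j : b.support} (hj : some j ∉ J) (hadj : (extendedDynkin b).Adj u (some j)) :
    0 < ⟪rootSum P (stdFace b {i | some i ∉ J}), P.root j⟫_ℝ := by
  obtain ⟨k, hk, hku⟩ := exists_root_coeff_lt b hP hJ u hu
  exact inner_rootSum_stdFace_pos b hP hj hk
    (inner_root_pos_of_adj b hP ((root_mem_stdFace b).mp hk j hj) hadj hku)

/-- At an edge from `J₁` to a node of `J₂` outside `J₁`, the common sum would be both positive on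
and orthogonal to that simple root. -/
lemma subset_of_rootSum_eq (b : P.Base)
    (hP : ∀ (i : ι) (x y : E), ⟪P.reflection i x, P.reflection i y⟫_ℝ = ⟪x, y⟫_ℝ)
    {J₁ J₂ : Set (Option b.support)} (h₁ : J₁ ∈ connectedSubdiagrams b)
    (h₂ : J₂ ∈ connectedSubdiagrams b)
    (h : rootSum P (stdFace b {i | some i ∉ J₁}) = rootSum P (stdFace b {i | some i ∉ J₂})) :
    J₂ ⊆ J₁ := by
  refine forall_of_induce_connected h₂.2 h₂.1 h₁.1 fun u _ v hv hadj hu => ?_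
  cases v with
  | none => exact h₁.1
  | some j =>
    by_contra hj
    have hpos := inner_rootSum_pos_of_adj b hP h₁ hu hj hadj
    rw [h, inner_rootSum_stdFace_of_notMem b hP (by simpa using hv)] at hpos
    exact lt_irrefl _ hpos

lemma injOn_orbit_stdFace (b : P.Base)
    (hP : ∀ (i : ι) (x y : E), ⟪P.reflection i x, P.reflection i y⟫_ℝ = ⟪x, y⟫_ℝ) :
    Set.InjOn (fun J : Set (Option b.support) =>
      MulAction.orbit P.weylGroup (stdFace b {i | some i ∉ J})) (connectedSubdiagrams b) := by
  intro J₁ h₁ J₂ h₂ h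
  obtain ⟨w, hw⟩ := MulAction.orbit_eq_iff.mp h.symm
  have hsum := eq_of_dominant_of_smul_eq hP b (inner_rootSum_stdFace_nonneg b hP _)
    (inner_rootSum_stdFace_nonneg b hP _) w
    ((smul_rootSum w _).trans (congrArg (rootSum P) hw))
  exact Set.Subset.antisymm (subset_of_rootSum_eq b hP h₂ h₁ hsum.symm)
    (subset_of_rootSum_eq b hP h₁ h₂ hsum)

/-- A root that agrees with the highest root outside `J` also agrees with it outside the connected
part `K` of `J` around the affine node. -/
lemma coeff_root_eq_of_notMem_part (b : P.Base)
    (hP : ∀ (i : ι) (x y : E), ⟪P.reflection i x, P.reflection i y⟫_ℝ = ⟪x, y⟫_ℝ)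
    {J K : Set (Option b.support)} (h0 : none ∈ K)
    (hcl : ∀ u ∈ K, ∀ v ∈ J, (extendedDynkin b).Adj u v → v ∈ K) {k : ι}
    (hk : ∀ i, some i ∉ J → coeff b i (P.root k) = coeff b i (highestRoot b))
    (i : b.support) (hi : some i ∉ K) :
    coeff b i (P.root k) = coeff b i (highestRoot b) := by
  have hθ : ∀ j : b.support, some j ∈ J → some j ∉ K → ⟪highestRoot b, P.root j⟫_ℝ = 0 :=
    fun j hj hj' => inner_highestRoot_eq_zero_of_not_adj b fun h => hj' (hcl _ h0 _ hj h)
  have hKJ : ∀ l j : b.support, some l ∈ K → some j ∈ J → some j ∉ K →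
      ⟪P.root l, P.root j⟫_ℝ = 0 := fun l j hl hj hj' =>
    inner_simple_eq_zero_of_not_adj b (by rintro rfl; exact hj' hl)
      fun h => hj' (hcl _ hl _ hj h)
  let bad : Set ι := {k | (∀ i, some i ∉ J → coeff b i (P.root k) = coeff b i (highestRoot b)) ∧
    ∃ i, some i ∉ K ∧ coeff b i (P.root k) ≠ coeff b i (highestRoot b)}
  by_contra hne
  -- Take a counterexample `g` of maximal height.
  obtain ⟨g, ⟨hgJ, i₁, hi₁K, hi₁⟩, hgmax⟩ :=
    Set.exists_max_image bad b.height bad.toFinite ⟨k, hk, i, hi, hne⟩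
  classical
  let d : b.support → ℝ := fun j => coeff b j (highestRoot b) - coeff b j (P.root g)
  have hd : ∀ j, 0 ≤ d j := fun j => sub_nonneg.mpr (coeff_root_le_highestRoot b hP g j)
  -- The part of `θ - g` outside `K`. It is nonzero and supported on `J \ K`, whose simple roots are
  -- orthogonal to `θ` and to those of `K`. Positivity of `⟪v, v⟫` then yields a node `j` there with
  -- `⟪g, αⱼ⟫ < 0`.
  let v : E := ∑ j : b.support, (if some j ∈ K then 0 else d j) • P.root j
  have hcoeffv : ∀ j, coeff b j v = if some j ∈ K then 0 else d j := by
    intro j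
    simp only [v, map_sum, map_smul]
    rw [Finset.sum_eq_single j, coeff_simple_self, smul_eq_mul, mul_one]
    · intro l _ hl
      rw [coeff_simple_of_ne b hl.symm, smul_zero]
    · simp
  have hvpos : 0 < ⟪v, v⟫_ℝ := by
    rw [real_inner_self_pos]
    intro hv
    have h := hcoeffv i₁
    rw [hv, map_zero, if_neg hi₁K] at h
    exact hi₁ (by simp only [d] at h; linarith)
  have hinner : ∀ j : b.support, some j ∈ J → some j ∉ K →
      ⟪P.root j, v⟫_ℝ = -⟪P.root g, P.root j⟫_ℝ := by
    intro j hj hj'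
    rw [real_inner_comm, inner_eq_sum_coeff b v, inner_eq_highestRoot_sub b (P.root g),
      hθ j hj hj', zero_add, ← Finset.sum_neg_distrib]
    refine Finset.sum_congr rfl fun l _ => ?_
    rw [hcoeffv]
    split_ifs with hl
    · rw [hKJ l j hl hj hj']; simp
    · simp [d]
  obtain ⟨j, hjK, hjJ, hneg⟩ :
      ∃ j : b.support, some j ∉ K ∧ some j ∈ J ∧ ⟪P.root g, P.root j⟫_ℝ < 0 := by
    by_contra! hcon
    refine hvpos.not_ge ?_
    rw [inner_eq_sum_coeff b]
    refine Finset.sum_nonpos fun j _ => ?_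
    rw [hcoeffv]
    split_ifs with hjK
    · simp
    by_cases hjJ : some j ∈ J
    · rw [hinner j hjJ hjK]
      exact mul_nonpos_of_nonneg_of_nonpos (hd j) (neg_nonpos.mpr (hcon j hjK hjJ))
    · simp [d, hgJ j hjJ]
  have hc := (coroot'_neg_iff hP j (P.root g)).mpr hneg
  -- Reflecting `g` in `αⱼ` raises its height, so the result is no counterexample: it differs from
  -- `θ` only on `K`. It is then orthogonal to `αⱼ`, and so is `g`, a contradiction.
  have hnot : P.reflectionPerm j g ∉ bad := by
    intro hbad
    have h : (b.height (P.reflectionPerm j g) : ℝ) ≤ b.height g := by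
      exact_mod_cast hgmax _ hbad
    rw [height_eq_sum_coeff, height_eq_sum_coeff, RootPairing.root_reflectionPerm,
      sum_coeff_reflection] at h
    linarith
  have hall : ∀ l, some l ∉ K →
      coeff b l (P.reflection j (P.root g)) = coeff b l (highestRoot b) := by
    intro l hl
    by_contra hl'
    refine hnot ⟨fun m hm => ?_, l, hl, by rwa [RootPairing.root_reflectionPerm]⟩
    rw [RootPairing.root_reflectionPerm, coeff_reflection_of_ne b, hgJ m hm]
    rintro rfl
    exact hm hjJ
  have hzero : ⟪P.reflection j (P.root g), P.root j⟫_ℝ = 0 := by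
    rw [inner_eq_highestRoot_sub b, hθ j hjJ hjK, zero_add]
    refine Finset.sum_eq_zero fun l _ => ?_
    by_cases hl : some l ∈ K
    · rw [hKJ l j hl hjJ hjK]; simp
    · rw [hall l hl, sub_self, zero_mul]
  rw [inner_reflection_root hP] at hzero
  linarith

lemma stdFace_eq_of_part (b : P.Base)
    (hP : ∀ (i : ι) (x y : E), ⟪P.reflection i x, P.reflection i y⟫_ℝ = ⟪x, y⟫_ℝ)
    {J K : Set (Option b.support)} (hKJ : K ⊆ J) (h0 : none ∈ K)
    (hcl : ∀ u ∈ K, ∀ v ∈ J, (extendedDynkin b).Adj u v → v ∈ K) :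
    stdFace b {i | some i ∉ K} = stdFace b {i | some i ∉ J} := by
  have := Fintype.ofFinite ι
  ext x
  rw [mem_stdFace, mem_stdFace]
  refine and_congr_right fun hx => ⟨fun h i hi => h i fun hiK => hi (hKJ hiK), fun h i hi => ?_⟩
  obtain ⟨w, hw0, hw1, rfl⟩ : ∃ w : ι → ℝ, (∀ k, 0 ≤ w k) ∧ ∑ k, w k = 1 ∧
      ∑ k, w k • P.root k = x := by
    have hx' : x ∈ convexHull ℝ ((Finset.univ.map P.root : Finset E) : Set E) := by
      simpa [polytope] using hx
    obtain ⟨w, hw0, hw1, hw⟩ := Finset.mem_convexHull'.mp hx'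
    rw [Finset.sum_map] at hw1 hw
    exact ⟨fun k => w (P.root k), fun k => hw0 _ (by simp), hw1, hw⟩
  have hdiff : ∀ i, coeff b i (highestRoot b) - coeff b i (∑ k, w k • P.root k) =
      ∑ k, w k * (coeff b i (highestRoot b) - coeff b i (P.root k)) := by
    intro i
    simp only [mul_sub, Finset.sum_sub_distrib, ← Finset.sum_mul, hw1, one_mul, map_sum, map_smul,
      smul_eq_mul]
  -- A convex combination attains a maximal coefficient only if every root of nonzero weight does;
  -- this reduces the claim to roots.
  have hzero : ∀ k, w k ≠ 0 → ∀ i, some i ∉ J →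
      coeff b i (P.root k) = coeff b i (highestRoot b) := by
    intro k hk i hi
    have h1 := hdiff i
    rw [h i hi, sub_self] at h1
    have h2 := (Finset.sum_eq_zero_iff_of_nonneg fun k _ => mul_nonneg (hw0 k)
      (sub_nonneg.mpr (coeff_root_le_highestRoot b hP k i))).mp h1.symm k (Finset.mem_univ k)
    have := (mul_eq_zero.mp h2).resolve_left hk
    linarith
  have h3 : coeff b i (highestRoot b) - coeff b i (∑ k, w k • P.root k) = 0 := by
    rw [hdiff]
    refine Finset.sum_eq_zero fun k _ => ?_
    by_cases hk : w k = 0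
    · rw [hk, zero_mul]
    · rw [coeff_root_eq_of_notMem_part b hP h0 hcl (hzero k hk) i hi, sub_self, mul_zero]
  linarith

lemma bijOn_orbit_stdFace (b : P.Base)
    (hP : ∀ (i : ι) (x y : E), ⟪P.reflection i x, P.reflection i y⟫_ℝ = ⟪x, y⟫_ℝ) :
    Set.BijOn (fun J : Set (Option b.support) =>
      MulAction.orbit P.weylGroup (stdFace b {i | some i ∉ J}))
      (connectedSubdiagrams b) (faceOrbits P) := by
  refine ⟨fun J _ => ⟨_, isFace_stdFace b hP _, rfl⟩, injOn_orbit_stdFace b hP, ?_⟩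
  rintro _ ⟨F, hF, rfl⟩
  obtain ⟨w, I, rfl⟩ := exists_smul_eq_stdFace b hP hF
  -- The complement of `I` with the affine node added; it is then cut down to the component of that
  -- node.
  let J : Set (Option b.support) := {u | ∀ i, u = some i → i ∉ I}
  have hJ : {i | some i ∉ J} = I := by
    ext i
    refine ⟨fun h => ?_, fun hi h => h i rfl hi⟩
    by_contra hi
    exact h fun j hj => by cases hj; exact hi
  obtain ⟨K, hKJ, h0, hconn, hcl⟩ :=
    exists_connected_part (J := J) (a := none) (by simp [J]) (extendedDynkin b)
  refine ⟨K, ⟨h0, hconn⟩, ?_⟩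
  change MulAction.orbit _ _ = _
  rw [stdFace_eq_of_part b hP hKJ h0 hcl, hJ, MulAction.orbit_smul]

end Diagram

-- Generated subsystems and orthogonality.

section AffineForm

variable {E : Type*} [NormedAddCommGroup E] [InnerProductSpace ℝ E]

lemma affineForm_comm (v w : E × ℝ) : affineForm v w = affineForm w v := real_inner_comm _ _

lemma affineForm_reflection_right (u v w : E × ℝ) :
    affineForm u (affineReflection v w) =
      affineForm u w - 2 * affineForm w v / affineForm v v * affineForm u v := by
  simp [affineForm, affineReflection, inner_sub_right, real_inner_smul_right]

lemma affineReflection_of_orthogonal {v w : E × ℝ} (h : affineForm w v = 0) :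
    affineReflection v w = w := by
  simp [affineReflection, h]

lemma affineForm_eq_zero_of_generated {S : Set (E × ℝ)} {u v : E × ℝ}
    (h : ∀ s ∈ S, affineForm u s = 0) (hv : Generated S v) : affineForm u v = 0 := by
  induction hv with
  | of v hv => exact h v hv
  | reflect v w _ _ ihv ihw => rw [affineForm_reflection_right, ihv, ihw]; simp

lemma Generated.mono {S T : Set (E × ℝ)} (hST : S ⊆ T) {v : E × ℝ} (hv : Generated S v) :
    Generated T v := by
  induction hv with
  | of v hv => exact .of v (hST hv)
  | reflect v w _ _ ihv ihw => exact .reflect v w ihv ihw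

lemma linear_eq_zero_of_generated {S : Set (E × ℝ)} (f : E × ℝ →ₗ[ℝ] ℝ)
    (h : ∀ s ∈ S, f s = 0) {v : E × ℝ} (hv : Generated S v) : f v = 0 := by
  induction hv with
  | of v hv => exact h v hv
  | reflect v w _ _ ihv ihw => simp [affineReflection, ihv, ihw]

/-- The subsystem generated by two mutually orthogonal sets is the union of the subsystems
generated by them. -/
lemma generated_union {S T : Set (E × ℝ)} (h : ∀ s ∈ S, ∀ t ∈ T, affineForm s t = 0) :
    {v | Generated (S ∪ T) v} = {v | Generated S v} ∪ {v | Generated T v} := by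
  have horth : ∀ v w, Generated S v → Generated T w → affineForm v w = 0 := by
    intro v w hv hw
    refine affineForm_eq_zero_of_generated (fun t ht => ?_) hw
    rw [affineForm_comm]
    exact affineForm_eq_zero_of_generated (fun s hs => by rw [affineForm_comm]; exact h s hs t ht) hv
  refine Set.Subset.antisymm (fun v hv => ?_) (Set.union_subset ?_ ?_)
  · change Generated (S ∪ T) v at hv
    induction hv with
    | of v hv => exact hv.imp (.of v) (.of v)
    | reflect v w _ _ ihv ihw =>
      -- In the mixed cases the two vectors are orthogonal and the reflection is trivial.
      rcases ihv with hv | hv <;> rcases ihw with hw | hw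
      · exact Or.inl (.reflect v w hv hw)
      · rw [affineReflection_of_orthogonal (by rw [affineForm_comm]; exact horth v w hv hw)]
        exact Or.inr hw
      · rw [affineReflection_of_orthogonal (horth w v hw hv)]
        exact Or.inl hw
      · exact Or.inr (.reflect v w hv hw)
  · exact fun v hv => Generated.mono Set.subset_union_left hv
  · exact fun v hv => Generated.mono Set.subset_union_right hv

end AffineForm

lemma affineForm_self_ne_zero {ι E N : Type*} [NormedAddCommGroup E] [InnerProductSpace ℝ E]
    [AddCommGroup N] [Module ℝ N] {P : RootPairing ι ℝ E N} {v : E × ℝ}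
    (hv : v ∈ affineRoots P) : affineForm v v ≠ 0 := by
  obtain ⟨i, k, rfl⟩ := hv
  exact (inner_root_self_pos P i).ne'

lemma affineReflection_mem_affineRoots {ι E N : Type*} [NormedAddCommGroup E]
    [InnerProductSpace ℝ E] [AddCommGroup N] [Module ℝ N] {P : RootPairing ι ℝ E N}
    [P.IsCrystallographic]
    (hP : ∀ (i : ι) (x y : E), ⟪P.reflection i x, P.reflection i y⟫_ℝ = ⟪x, y⟫_ℝ)
    {v w : E × ℝ} (hv : v ∈ affineRoots P) (hw : w ∈ affineRoots P) :
    affineReflection v w ∈ affineRoots P := by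
  obtain ⟨i, k, rfl⟩ := hv
  obtain ⟨j, l, rfl⟩ := hw
  -- The coefficient of `δ` stays integral because the pairing is an integer.
  refine ⟨P.reflectionPerm i j, l - P.pairingIn ℤ j i * k, ?_⟩
  have hc : 2 * ⟪P.root j, P.root i⟫_ℝ / ⟪P.root i, P.root i⟫_ℝ = P.pairingIn ℤ j i := by
    rw [← coroot'_eq hP, RootPairing.root_coroot'_eq_pairing, ← P.algebraMap_pairingIn ℤ]
    rfl
  rw [RootPairing.root_reflectionPerm, RootPairing.reflection_apply, coroot'_eq hP, hc]
  simp only [affineReflection, affineForm, hc]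
  ext <;> simp

-- Irreducible parabolic subsystems and connected subdiagrams.

section Parabolic

variable {ι E N : Type*} [Finite ι] [NormedAddCommGroup E] [InnerProductSpace ℝ E]
  [AddCommGroup N] [Module ℝ N] {P : RootPairing ι ℝ E N} [P.IsRootSystem]
  [P.IsIrreducible]

lemma affineSimpleRoot_mem_affineRoots (b : P.Base) (u : Option b.support) :
    affineSimpleRoot b u ∈ affineRoots P := by
  cases u with
  | none =>
    obtain ⟨t, ht⟩ := highestRoot_mem_range b
    refine ⟨P.reflectionPerm t t, 1, ?_⟩
    rw [RootPairing.root_reflectionPerm, RootPairing.reflection_apply_self, ht]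
    simp [affineSimpleRoot]
  | some i => exact ⟨i, 0, by simp [affineSimpleRoot]⟩

lemma affineSimpleRoot_mem_parabolicSubsystem (b : P.Base) {J : Set (Option b.support)}
    {u : Option b.support} (hu : u ∈ J) : affineSimpleRoot b u ∈ parabolicSubsystem b J :=
  .of _ ⟨u, hu, rfl⟩

/-- Membership of nonaffine nodes can be read off from the parabolic subsystem. -/
lemma affineSimpleRoot_some_mem_iff (b : P.Base) {J : Set (Option b.support)} {i : b.support} :
    affineSimpleRoot b (some i) ∈ parabolicSubsystem b J ↔ some i ∈ J := by
  refine ⟨fun h => ?_, affineSimpleRoot_mem_parabolicSubsystem b⟩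
  by_contra hi
  -- The coordinate at `αᵢ` in the basis of affine simple roots: the term `mᵢ k` makes it vanish on
  -- `α₀ = -θ + δ`.
  let f : E × ℝ →ₗ[ℝ] ℝ :=
    (coeff b i).comp (LinearMap.fst ℝ E ℝ) + coeff b i (highestRoot b) • LinearMap.snd ℝ E ℝ
  have hf := linear_eq_zero_of_generated f ?_ h
  · simp [f, affineSimpleRoot, coeff_simple_self] at hf
  · rintro _ ⟨u, hu, rfl⟩
    cases u with
    | none => simp [f, affineSimpleRoot]
    | some j =>
      have hij : i ≠ j := by rintro rfl; exact hi hu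
      simp [f, affineSimpleRoot, coeff_simple_of_ne b hij]

lemma snd_eq_zero_of_mem_parabolicSubsystem (b : P.Base) {J : Set (Option b.support)}
    (h0 : none ∉ J) {v : E × ℝ} (hv : v ∈ parabolicSubsystem b J) : v.2 = 0 := by
  refine linear_eq_zero_of_generated (LinearMap.snd ℝ E ℝ) ?_ hv
  rintro _ ⟨u, hu, rfl⟩
  cases u with
  | none => exact absurd hu h0
  | some j => simp [affineSimpleRoot]

variable [P.IsCrystallographic]

lemma parabolicSubsystem_subset_affineRoots (b : P.Base)
    (hP : ∀ (i : ι) (x y : E), ⟪P.reflection i x, P.reflection i y⟫_ℝ = ⟪x, y⟫_ℝ)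
    (J : Set (Option b.support)) : parabolicSubsystem b J ⊆ affineRoots P := by
  intro v hv
  change Generated _ v at hv
  induction hv with
  | of v hv =>
    obtain ⟨u, -, rfl⟩ := hv
    exact affineSimpleRoot_mem_affineRoots b u
  | reflect v w _ _ ihv ihw => exact affineReflection_mem_affineRoots hP ihv ihw

/-- Adjacent simple roots lie on the same side of an orthogonal splitting, so connectedness puts all
of them on the side of `α₀`. Elements of the other side are orthogonal to all generators, hence to
themselves, which no affine root is. -/
lemma isIrreducibleSubsystem_of_connected (b : P.Base)
    (hP : ∀ (i : ι) (x y : E), ⟪P.reflection i x, P.reflection i y⟫_ℝ = ⟪x, y⟫_ℝ)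
    {J : Set (Option b.support)} (hJ : J ∈ connectedSubdiagrams b) :
    IsIrreducibleSubsystem (parabolicSubsystem b J) := by
  have key : ∀ A B : Set (E × ℝ), A ∪ B = parabolicSubsystem b J →
      (∀ v ∈ A, ∀ w ∈ B, affineForm v w = 0) → affineSimpleRoot b none ∈ A → B = ∅ := by
    intro A B hAB horth h0
    have hA : ∀ u ∈ J, affineSimpleRoot b u ∈ A := by
      refine forall_of_induce_connected hJ.2 hJ.1 h0 fun u _ v hv hadj hu => ?_
      have hv' : affineSimpleRoot b v ∈ A ∪ B :=
        hAB ▸ affineSimpleRoot_mem_parabolicSubsystem b hv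
      exact hv'.resolve_right fun hvB => hadj.2 (horth _ hu _ hvB)
    refine Set.eq_empty_of_forall_notMem fun w hw => ?_
    have hwJ : w ∈ parabolicSubsystem b J := hAB ▸ Or.inr hw
    refine affineForm_self_ne_zero (parabolicSubsystem_subset_affineRoots b hP J hwJ) ?_
    refine affineForm_eq_zero_of_generated ?_ hwJ
    rintro _ ⟨u, hu, rfl⟩
    rw [affineForm_comm]
    exact horth _ (hA u hu) _ hw
  have h0 := affineSimpleRoot_mem_parabolicSubsystem b hJ.1
  refine ⟨⟨_, h0⟩, fun A B hAB horth => ?_⟩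
  rw [← hAB] at h0
  rcases h0 with h0 | h0
  · exact Or.inr (key A B hAB horth h0)
  · refine Or.inl (key B A (by rw [Set.union_comm, hAB]) (fun v hv w hw => ?_) h0)
    rw [affineForm_comm]
    exact horth w hw v hv

/-- Without the affine node no `δ` appears. With it, its component `K` and `J \ K` generate
orthogonal subsystems that together make up the whole, so irreducibility leaves nothing in `J \ K`.
-/
lemma mem_connectedSubdiagrams_of_irreducible (b : P.Base)
    (hP : ∀ (i : ι) (x y : E), ⟪P.reflection i x, P.reflection i y⟫_ℝ = ⟪x, y⟫_ℝ)
    {J : Set (Option b.support)} (hirr : IsIrreducibleSubsystem (parabolicSubsystem b J))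
    (hfin : ¬ parabolicSubsystem b J ⊆ finiteRoots P) : J ∈ connectedSubdiagrams b := by
  have h0 : none ∈ J := by
    by_contra h0
    refine hfin fun v hv => ?_
    obtain ⟨i, k, rfl⟩ := parabolicSubsystem_subset_affineRoots b hP J hv
    exact ⟨i, congrArg (Prod.mk _) (snd_eq_zero_of_mem_parabolicSubsystem b h0 hv)⟩
  obtain ⟨K, hKJ, h0K, hconn, hcl⟩ := exists_connected_part h0 (extendedDynkin b)
  have horth : ∀ s ∈ affineSimpleRoot b '' K, ∀ t ∈ affineSimpleRoot b '' (J \ K),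
      affineForm s t = 0 := by
    rintro _ ⟨u, hu, rfl⟩ _ ⟨v, hv, rfl⟩
    by_contra hne
    exact hv.2 (hcl u hu v hv.1 ⟨by rintro rfl; exact hv.2 hu, hne⟩)
  have hunion : parabolicSubsystem b K ∪ parabolicSubsystem b (J \ K) = parabolicSubsystem b J := by
    have h := generated_union horth
    rw [← Set.image_union, Set.union_sdiff_cancel hKJ] at h
    exact h.symm
  have hempty : parabolicSubsystem b (J \ K) = ∅ := by
    refine (hirr.2 _ _ hunion fun v hv w hw => ?_).resolve_left ?_
    · refine affineForm_eq_zero_of_generated (fun t ht => ?_) hw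
      rw [affineForm_comm]
      refine affineForm_eq_zero_of_generated (fun s hs => ?_) hv
      rw [affineForm_comm]
      exact horth s hs t ht
    · exact Set.Nonempty.ne_empty ⟨_, affineSimpleRoot_mem_parabolicSubsystem b h0K⟩
  have hJK : J ⊆ K := by
    intro u hu
    by_contra huK
    have h : affineSimpleRoot b u ∈ parabolicSubsystem b (J \ K) :=
      affineSimpleRoot_mem_parabolicSubsystem b ⟨hu, huK⟩
    rw [hempty] at h
    exact h
  rw [Set.Subset.antisymm hJK hKJ]
  exact ⟨h0K, hconn⟩

lemma bijOn_parabolicSubsystem (b : P.Base)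
    (hP : ∀ (i : ι) (x y : E), ⟪P.reflection i x, P.reflection i y⟫_ℝ = ⟪x, y⟫_ℝ) :
    Set.BijOn (parabolicSubsystem b) (connectedSubdiagrams b) (irreducibleParabolics b) := by
  refine ⟨fun J hJ => ⟨parabolicSubsystem_subset_affineRoots b hP J, ⟨J, rfl⟩,
    isIrreducibleSubsystem_of_connected b hP hJ, fun hfin => ?_⟩, fun J hJ K hK h => ?_, ?_⟩
  · obtain ⟨i, hi⟩ := hfin (affineSimpleRoot_mem_parabolicSubsystem b hJ.1)
    exact one_ne_zero (congrArg Prod.snd hi)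
  · ext u
    cases u with
    | none => exact iff_of_true hJ.1 hK.1
    | some i => rw [← affineSimpleRoot_some_mem_iff b, h, affineSimpleRoot_some_mem_iff]
  · rintro _ ⟨-, ⟨J, rfl⟩, hirr, hfin⟩
    exact ⟨J, mem_connectedSubdiagrams_of_irreducible b hP hirr hfin, rfl⟩

end Parabolic

end RootPolytope

theorem theorem5p7 {ι E N : Type*} [Finite ι]
    [NormedAddCommGroup E] [InnerProductSpace ℝ E] [AddCommGroup N] [Module ℝ N]
    (P : RootPairing ι ℝ E N) [P.IsRootSystem] [P.IsCrystallographic] [P.IsReduced]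
    [P.IsIrreducible]
    (hP : ∀ (i : ι) (x y : E), ⟪P.reflection i x, P.reflection i y⟫_ℝ = ⟪x, y⟫_ℝ)
    (b : P.Base) :
    -- connected subdiagrams containing the affine node ↔ orbits of faces
    Set.BijOn
      (fun J : Set (Option b.support) =>
        MulAction.orbit P.weylGroup (RootPolytope.stdFace b {i | some i ∉ J}))
      (RootPolytope.connectedSubdiagrams b) (RootPolytope.faceOrbits P) ∧
    -- connected subdiagrams containing the affine node ↔ irreducible parabolic subsystems
    Set.BijOn (RootPolytope.parabolicSubsystem b)
      (RootPolytope.connectedSubdiagrams b) (RootPolytope.irreducibleParabolics b) ∧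
    -- irreducible parabolic subsystems not included in the finite system ↔ orbits of faces
    Set.BijOn
      (fun R : Set (E × ℝ) =>
        MulAction.orbit P.weylGroup
          (RootPolytope.stdFace b {i | RootPolytope.affineSimpleRoot b (some i) ∉ R}))
      (RootPolytope.irreducibleParabolics b) (RootPolytope.faceOrbits P) := by
  have h₁ := RootPolytope.bijOn_orbit_stdFace b hP
  have h₂ := RootPolytope.bijOn_parabolicSubsystem b hP
  refine ⟨h₁, h₂, ?_⟩
  -- The third map composed with the second is the first, since `J` and its subsystem contain the
  -- same nonaffine simple roots.
  rw [← h₂.image_eq, ← Set.bijOn_comp_iff h₂.injOn]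
  simpa only [Function.comp_def, RootPolytope.affineSimpleRoot_some_mem_iff] using h₁
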